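/- A numerical semigroup is a submonoid $S$ of $(\mathbb{N},+)$, where $\mathbb{N}=\{0,1,2,\dots\}$, such that $\mathbb{N}\setminus S$ is finite. The primitives of $S$ are the elements of the smallest finite set (with respect to inclusion) that generates $S$, the maximum primitive of $S$ is the largest of its primitives, and the Frobenius number of $S$ is the largest integer that does not belong to $S$. For a positive integer $n$, let $A_n$ be the number of numerical semigroups with maximum primitive $n$, and let $N_n$ be the number of numerical semigroups with Frobenius number $n$. Then $$A_{61}=2640706082,\qquad A_{62}=2606696049,\qquad N_{61}=2640706083,\qquad N_{62}=2606766903.$$ -/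

import Mathlib

/-- A numerical semigroup: a submonoid of `(ℕ, +)` with finite complement. -/
def IsNumericalSemigroup (S : AddSubmonoid ℕ) : Prop :=
  ((S : Set ℕ)ᶜ).Finite

/-- `P` is the set of primitives (minimal generators) of `S`: the smallest finite set, with
respect to inclusion, that generates `S` as a submonoid of `ℕ`. -/
def IsSetOfPrimitives (S : AddSubmonoid ℕ) (P : Finset ℕ) : Prop :=
  IsLeast {A : Finset ℕ | AddSubmonoid.closure (A : Set ℕ) = S} P

/-- `n` is the maximum primitive of `S`. -/
def HasMaxPrimitive (S : AddSubmonoid ℕ) (n : ℕ) : Prop :=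
  ∃ P : Finset ℕ, IsSetOfPrimitives S P ∧ IsGreatest (P : Set ℕ) n

/-- The set of numerical semigroups with maximum primitive `n`. -/
def maxPrimSet (n : ℕ) : Set (AddSubmonoid ℕ) :=
  {S | IsNumericalSemigroup S ∧ HasMaxPrimitive S n}

/-- The set of numerical semigroups with Frobenius number `n`, i.e. such that `n` is the largest
integer that does not belong to the semigroup (`FrobeniusNumber` takes any set of generators,
here the whole semigroup). -/
def frobSet (n : ℕ) : Set (AddSubmonoid ℕ) :=
  {S | IsNumericalSemigroup S ∧ FrobeniusNumber n (S : Set ℕ)}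

/-- The number `A_n` of numerical semigroups with maximum primitive `n`. -/
noncomputable def maxPrimCard (n : ℕ) : ℕ := (maxPrimSet n).ncard

/-- The number `N_n` of numerical semigroups with Frobenius number `n`. -/
noncomputable def frobCard (n : ℕ) : ℕ := (frobSet n).ncard

/-! A semigroup with Frobenius number `n` contains everything above `n`, so it amounts to its trace
`T` on `[0, n)`: `0 ∈ T`, sums below `n` stay in `T`, and no two elements sum to `n`
(`frobCard_eq`). A semigroup with maximum primitive `n` is generated by `n` and its trace. That `n`
is primitive says again that no two elements of the trace sum to `n`; finite complement adds only
that `T` and `n` have no common divisor except `1` (`maxPrimCard_eq`).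

For a prime `p` this excludes only `{0}`, so `A_p = N_p - 1`. For `2 * p` it excludes exactly the
traces of even numbers, which are the doubled traces for `p`, so `A_{2p} = N_{2p} - N_p`. It remains
to compute `N_31`, `N_61` and `N_62`.

The traces are counted by a search tree that decides, in increasing order, which numbers below `n /
2` belong to `T`. Accepting `k` closes the forced set `S` under adding `k`; the branch dies if `n`
becomes a sum. Two elements above `n / 2` have sum greater than `n`, so they do not constrain each
other beyond being translates by `S`: at a leaf the completions are the sets of free numbers closed
under adding elements of `S` (`IsState.card_truncFamilyOver`). These are counted by branching on the
least free number (`card_upFamily_of_min`). All sets are bitmasks, so that the kernel can run the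
count. -/

/-! ### Counting translation-closed sets with bitmasks -/

/-- The positions of the binary digits `1` of `F`. -/
def bits (F : ℕ) : Finset ℕ := (Finset.range F).filter fun i => F.testBit i = true

theorem mem_bits {F i : ℕ} : i ∈ bits F ↔ F.testBit i = true := by
  simp only [bits, Finset.mem_filter, Finset.mem_range, and_iff_right_iff_imp]
  exact fun h => lt_of_lt_of_le Nat.lt_two_pow_self (Nat.ge_two_pow_of_testBit h)

/-- Subtracting `1` changes only the digits up to the lowest `1`, so `F &&& (F - 1)` erases just
that digit. Halving `F` gives the induction. -/
theorem exists_lowest_bit (F : ℕ) (hF : F ≠ 0) :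
    ∃ x, F.testBit x = true ∧ (∀ y, F.testBit y = true → x ≤ y) ∧
      ∀ i, (F &&& (F - 1)).testBit i = true ↔ F.testBit i = true ∧ i ≠ x := by
  induction F using Nat.strong_induction_on with
  | _ F ih =>
  rcases Nat.even_or_odd' F with ⟨k, rfl | rfl⟩
  · obtain ⟨x, h1, h2, h3⟩ := ih k (by omega) (by omega)
    have e : 2 * k - 1 = 2 * (k - 1) + 1 := by omega
    refine ⟨x + 1, ?_, ?_, ?_⟩
    · simpa [Nat.testBit_succ] using h1
    · rintro (_ | y) hy
      · simp at hy
      · have := h2 y (by simpa [Nat.testBit_succ] using hy)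
        omega
    · rintro (_ | i)
      · simp
      · have := h3 i
        rw [Nat.testBit_land] at this
        rw [e, Nat.testBit_land, Nat.testBit_succ, Nat.testBit_succ,
          show 2 * k / 2 = k by omega, show (2 * (k - 1) + 1) / 2 = k - 1 by omega, this]
        simp
  · refine ⟨0, by simp, fun _ _ => Nat.zero_le _, ?_⟩
    rintro (_ | i)
    · simp
    · rw [Nat.testBit_land, Nat.testBit_succ, Nat.testBit_succ,
        show (2 * k + 1) / 2 = k by omega, show (2 * k + 1 - 1) / 2 = k by omega]
      simp

/-- The subsets `X` of `E` such that `x ∈ X`, `a ∈ A` and `x + a ∈ E` imply `x + a ∈ X`. -/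
noncomputable def upFamily (A : Set ℕ) (E : Finset ℕ) : Finset (Finset ℕ) := by
  classical
  exact E.powerset.filter fun X => ∀ x ∈ X, ∀ a ∈ A, x + a ∈ E → x + a ∈ X

theorem mem_upFamily {A : Set ℕ} {E X : Finset ℕ} :
    X ∈ upFamily A E ↔ X ⊆ E ∧ ∀ x ∈ X, ∀ a ∈ A, x + a ∈ E → x + a ∈ X := by
  simp [upFamily]

theorem upFamily_empty (A : Set ℕ) : (upFamily A ∅).card = 1 := by
  rw [Finset.card_eq_one]
  refine ⟨∅, ?_⟩
  ext X
  simp only [mem_upFamily, Finset.subset_empty, Finset.mem_singleton]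
  exact ⟨fun h => h.1, fun h => ⟨h, by simp [h]⟩⟩

/-- Branch on whether the least element `x` lies in `X`. If not, there is no further condition,
because translates of larger elements never reach `x`. If so, every `x + a` in `E` is forced and `H`
is what stays undecided; by `hA` a translate of a forced element is forced, so forced elements
impose nothing on `H`. -/
theorem card_upFamily_of_min {A : Set ℕ} {E G H : Finset ℕ} {x : ℕ} (hx : x ∈ E)
    (hmin : ∀ y ∈ E, x ≤ y) (hA : ∀ a ∈ A, ∀ b ∈ A, x + (a + b) ∈ E → a + b ∈ A)
    (hG : ∀ i, i ∈ G ↔ i ∈ E ∧ i ≠ x) (hH : ∀ i, i ∈ H ↔ i ∈ G ∧ ¬ ∃ a ∈ A, i = x + a) :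
    (upFamily A E).card = (upFamily A G).card + (upFamily A H).card := by
  classical
  rw [← Finset.card_filter_add_card_filter_not (s := upFamily A E) (fun X => x ∉ X)]
  congr 1
  · congr 1
    ext X
    simp only [Finset.mem_filter, mem_upFamily]
    constructor
    · rintro ⟨⟨h1, h2⟩, h3⟩
      refine ⟨fun y hy => (hG y).2 ⟨h1 hy, fun e => h3 (e ▸ hy)⟩, fun y hy a ha h => ?_⟩
      exact h2 y hy a ha ((hG _).1 h).1
    · rintro ⟨h1, h2⟩
      have h3 : x ∉ X := fun h => ((hG x).1 (h1 h)).2 rfl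
      refine ⟨⟨fun y hy => ((hG y).1 (h1 hy)).1, fun y hy a ha h => ?_⟩, h3⟩
      refine h2 y hy a ha ((hG _).2 ⟨h, ?_⟩)
      have h4 := (hG y).1 (h1 hy)
      have h5 := hmin y h4.1
      have := h4.2
      omega
  · refine Finset.card_nbij' (fun X => X.filter (· ∈ H)) (fun X => X ∪ E.filter (· ∉ H)) ?_ ?_ ?_ ?_
    · intro X hX
      simp only [Finset.coe_filter, Set.mem_ofPred, mem_upFamily, not_not] at hX
      obtain ⟨⟨h1, h2⟩, h3⟩ := hX
      simp only [Finset.mem_coe, mem_upFamily, Finset.mem_filter]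
      refine ⟨fun y hy => (Finset.mem_filter.1 hy).2, fun y hy a ha h => ⟨?_, h⟩⟩
      exact h2 y hy.1 a ha ((hG _).1 ((hH _).1 h).1).1
    · intro X hX
      simp only [Finset.mem_coe, mem_upFamily] at hX
      obtain ⟨h1, h2⟩ := hX
      have hHE : ∀ y ∈ H, y ∈ E := fun y hy => ((hG y).1 ((hH y).1 hy).1).1
      simp only [Finset.coe_filter, Set.mem_ofPred, mem_upFamily, not_not, Finset.mem_union,
        Finset.mem_filter]
      refine ⟨⟨?_, ?_⟩, Or.inr ⟨hx, fun h => ((hG x).1 ((hH x).1 h).1).2 rfl⟩⟩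
      · intro y hy
        rcases Finset.mem_union.1 hy with hy | hy
        · exact hHE y (h1 hy)
        · exact (Finset.mem_filter.1 hy).1
      · intro y hy a ha h
        by_cases hya : y + a ∈ H
        · left
          rcases hy with hy | ⟨hy, hyH⟩
          · exact h2 y hy a ha hya
          · exfalso
            rw [hH] at hya
            rw [hH, hG] at hyH
            apply hya.2
            by_cases e : y = x
            · exact ⟨a, ha, by rw [e]⟩
            · have : ∃ b ∈ A, y = x + b := by
                by_contra hc
                exact hyH ⟨⟨hy, e⟩, hc⟩
              obtain ⟨b, hb, rfl⟩ := this
              rw [add_assoc] at h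
              exact ⟨b + a, hA b hb a ha h, by rw [add_assoc]⟩
        · exact Or.inr ⟨h, hya⟩
    · intro X hX
      simp only [Finset.coe_filter, Set.mem_ofPred, mem_upFamily, not_not] at hX
      obtain ⟨⟨h1, h2⟩, h3⟩ := hX
      ext y
      simp only [Finset.mem_union, Finset.mem_filter]
      constructor
      · rintro (h | ⟨h, hy⟩)
        · exact h.1
        · by_cases e : y = x
          · exact e ▸ h3
          · have : ∃ b ∈ A, y = x + b := by
              by_contra hc
              exact hy ((hH y).2 ⟨(hG y).2 ⟨h, e⟩, hc⟩)
            obtain ⟨b, hb, rfl⟩ := this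
            exact h2 x h3 b hb h
      · intro h
        by_cases hy : y ∈ H
        · exact Or.inl ⟨h, hy⟩
        · exact Or.inr ⟨h1 h, hy⟩
    · intro X hX
      simp only [Finset.mem_coe, mem_upFamily] at hX
      ext y
      simp only [Finset.mem_union, Finset.mem_filter]
      constructor
      · rintro ⟨h | h, h'⟩
        · exact h
        · exact absurd h' h.2
      · exact fun h => ⟨Or.inl h, hX.1 h⟩

/-- Counts the members of `upFamily` for the sets of binary digits of `S` and `F`, provided that
`F` has at most `fuel` digits `1`. Recursors on computed values make the kernel evaluate them. -/
noncomputable def countUp (S fuel : ℕ) : ℕ → ℕ :=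
  Nat.rec (fun _ => nat_lit 1)
    (fun _ ih F =>
      Nat.rec (nat_lit 1)
        (fun F' _ =>
          Nat.rec (nat_lit 2)
            (fun G' _ =>
              Nat.rec (Nat.mul (nat_lit 2) (ih (Nat.succ G')))
                (fun D' _ => Nat.add (ih (Nat.succ G')) (ih (Nat.xor (Nat.succ G') (Nat.succ D'))))
                (Nat.land (Nat.mul S (Nat.xor (Nat.succ F') (Nat.succ G'))) (Nat.succ G')))
            (Nat.land (Nat.succ F') F')) F) fuel

theorem countUp_zero_right (S fuel : ℕ) : countUp S fuel 0 = 1 := by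
  cases fuel <;> rfl

/-- The two shortcuts in `countUp`, the value `2` when one digit is left and doubling when nothing
new is forced, agree with the general recursion. -/
theorem countUp_succ (S fuel F : ℕ) (hF : F ≠ 0) :
    countUp S (fuel + 1) F = countUp S fuel (F &&& (F - 1)) +
      countUp S fuel ((F &&& (F - 1)) ^^^ (S * (F ^^^ (F &&& (F - 1))) &&& (F &&& (F - 1)))) := by
  obtain ⟨F', rfl⟩ := Nat.exists_eq_succ_of_ne_zero hF
  set G := F'.succ &&& (F'.succ - 1) with hG
  change (Nat.rec (nat_lit 2) _ G : ℕ) = _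
  rcases G with _ | G'
  · simp [countUp_zero_right]
  · change (Nat.rec _ _ (S * (F'.succ ^^^ G'.succ) &&& G'.succ) : ℕ) = _
    generalize S * (F'.succ ^^^ G'.succ) &&& G'.succ = D
    rcases D with _ | D'
    · rw [Nat.xor_zero]
      exact two_mul _
    · rfl

theorem countUp_eq {n S : ℕ} (hS : ∀ i j, S.testBit i = true → S.testBit j = true → i + j < n →
    S.testBit (i + j) = true) (fuel F : ℕ) (hF : ∀ i, F.testBit i = true → i < n)
    (hc : (bits F).card ≤ fuel) :
    countUp S fuel F = (upFamily {a | S.testBit a = true} (bits F)).card := by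
  induction fuel generalizing F with
  | zero =>
    rw [Nat.le_zero, Finset.card_eq_zero] at hc
    rw [hc, upFamily_empty]
    rfl
  | succ fuel ih =>
    by_cases h0 : F = 0
    · subst h0
      have : bits 0 = ∅ := rfl
      rw [countUp_zero_right, this, upFamily_empty]
    obtain ⟨x, h1, h2, h3⟩ := exists_lowest_bit F h0
    rw [countUp_succ S fuel F h0]
    generalize F &&& (F - 1) = G at h3 ⊢
    -- Multiplying `S` by the isolated lowest digit shifts it by `x`, which yields the bitmask of
    -- the translates `x + a`.
    have e : F ^^^ G = 2 ^ x := by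
      apply Nat.eq_of_testBit_eq
      intro i
      have h4 := h3 i
      rw [Nat.testBit_xor, Nat.testBit_two_pow]
      by_cases hi : x = i
      · subst hi
        have : G.testBit x = false := by simpa using h4
        simp [h1, this]
      · have : F.testBit i = G.testBit i := by
          rw [Bool.eq_iff_iff, h4]
          exact ⟨fun h => ⟨h, Ne.symm hi⟩, fun h => h.1⟩
        simp [this, hi]
    have hGn : (bits G).card ≤ fuel := by
      have : bits G = (bits F).erase x := by
        ext i
        rw [mem_bits, h3, Finset.mem_erase, mem_bits, and_comm]
      rw [this, Finset.card_erase_of_mem (mem_bits.2 h1)]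
      omega
    have hD : ∀ i, (G ^^^ (S * 2 ^ x &&& G)).testBit i = true ↔
        G.testBit i = true ∧ ¬ ∃ a, S.testBit a = true ∧ i = x + a := by
      intro i
      have : (S * 2 ^ x).testBit i = true ↔ ∃ a, S.testBit a = true ∧ i = x + a := by
        rw [Nat.testBit_mul_two_pow]
        simp only [Bool.and_eq_true, decide_eq_true_eq]
        constructor
        · rintro ⟨h, h'⟩
          exact ⟨i - x, h', by omega⟩
        · rintro ⟨a, h, rfl⟩
          exact ⟨by omega, by simpa using h⟩
      rw [← this, Nat.testBit_xor, Nat.testBit_land]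
      cases G.testBit i <;> cases (S * 2 ^ x).testBit i <;> simp
    rw [e, ih G (fun i hi => hF i ((h3 i).1 hi).1) hGn, ih _ (fun i hi => hF i ((h3 i).1 ((hD i).1 hi).1).1)
      ((Finset.card_le_card fun i hi => mem_bits.2 ((hD i).1 (mem_bits.1 hi)).1).trans hGn)]
    symm
    refine card_upFamily_of_min (x := x) (mem_bits.2 h1) (fun y hy => h2 y (mem_bits.1 hy)) ?_ ?_ ?_
    · intro a ha b hb h
      have := hF _ (mem_bits.1 h)
      exact hS a b ha hb (by omega)
    · intro i
      rw [mem_bits, mem_bits, h3]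
    · intro i
      rw [mem_bits, mem_bits, hD]
      rfl
-- The search tree over the lower half
/-- The traces on `[0, n)` of the submonoids of `ℕ` with Frobenius number `n`. -/
noncomputable def truncFamily (n : ℕ) : Finset (Finset ℕ) := by
  classical
  exact (Finset.range n).powerset.filter fun T =>
    0 ∈ T ∧ ∀ a ∈ T, ∀ b ∈ T, a + b ≠ n ∧ (a + b < n → a + b ∈ T)

theorem mem_truncFamily {n : ℕ} {T : Finset ℕ} : T ∈ truncFamily n ↔ (∀ a ∈ T, a < n) ∧
    0 ∈ T ∧ ∀ a ∈ T, ∀ b ∈ T, a + b ≠ n ∧ (a + b < n → a + b ∈ T) := by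
  simp [truncFamily, Finset.subset_iff]

/-- The members of `truncFamily n` that agree with the set of binary digits of `S` below `k`. -/
noncomputable def truncFamilyOver (n k S : ℕ) : Finset (Finset ℕ) := by
  classical
  exact (truncFamily n).filter fun T => ∀ i < k, i ∈ T ↔ S.testBit i = true

theorem mem_truncFamilyOver {n k S : ℕ} {T : Finset ℕ} : T ∈ truncFamilyOver n k S ↔
    T ∈ truncFamily n ∧ ∀ i < k, i ∈ T ↔ S.testBit i = true := by
  simp [truncFamilyOver]

/-- The value `f x`, with `x` evaluated first. -/
noncomputable def force (x : ℕ) (f : ℕ → ℕ) : ℕ :=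
  Nat.rec (f (nat_lit 0)) (fun y _ => f (Nat.succ y)) x

theorem force_eq (x : ℕ) (f : ℕ → ℕ) : force x f = f x := by
  cases x <;> rfl

/-- The sums of a digit of `S` and a multiple `j * k` with `j < 2 ^ t`. -/
noncomputable def closeLeft (S k t : ℕ) : ℕ :=
  Nat.rec S (fun j T => Nat.lor T (Nat.shiftLeft T (Nat.mul k (Nat.pow 2 j)))) t

/-- The differences of a digit of `R` and a multiple `j * k` with `j < 2 ^ t`. -/
noncomputable def closeRight (R k t : ℕ) : ℕ :=
  Nat.rec R (fun j T => Nat.lor T (Nat.shiftRight T (Nat.mul k (Nat.pow 2 j)))) t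

/-- Each round doubles the range of multipliers, by splitting `j < 2 ^ (t + 1)` according to whether
`j < 2 ^ t`. -/
theorem testBit_closeLeft (S k t i : ℕ) : (closeLeft S k t).testBit i = true ↔
    ∃ j < 2 ^ t, ∃ s, S.testBit s = true ∧ i = s + j * k := by
  induction t generalizing i with
  | zero => simp [closeLeft]
  | succ t ih =>
    change (closeLeft S k t ||| closeLeft S k t <<< (k * 2 ^ t)).testBit i = true ↔ _
    rw [Nat.testBit_lor, Bool.or_eq_true, ih, Nat.testBit_shiftLeft, Bool.and_eq_true, ih,
      decide_eq_true_eq, pow_succ]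
    constructor
    · rintro (⟨j, hj, s, hs, rfl⟩ | ⟨hi, j, hj, s, hs, h⟩)
      · exact ⟨j, by omega, s, hs, rfl⟩
      · refine ⟨j + 2 ^ t, by omega, s, hs, ?_⟩
        rw [add_mul, mul_comm (2 ^ t)]
        omega
    · rintro ⟨j, hj, s, hs, rfl⟩
      by_cases h : j < 2 ^ t
      · exact Or.inl ⟨j, h, s, hs, rfl⟩
      · obtain ⟨j, rfl⟩ := Nat.exists_eq_add_of_le (not_lt.1 h)
        refine Or.inr ⟨?_, j, by omega, s, hs, ?_⟩ <;> rw [add_mul, mul_comm (2 ^ t)] <;> omega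

theorem testBit_closeRight (R k t i : ℕ) : (closeRight R k t).testBit i = true ↔
    ∃ j < 2 ^ t, R.testBit (i + j * k) = true := by
  induction t generalizing i with
  | zero => simp [closeRight]
  | succ t ih =>
    change (closeRight R k t ||| closeRight R k t >>> (k * 2 ^ t)).testBit i = true ↔ _
    rw [Nat.testBit_lor, Bool.or_eq_true, ih, Nat.testBit_shiftRight, ih, pow_succ]
    constructor
    · rintro (⟨j, hj, h⟩ | ⟨j, hj, h⟩)
      · exact ⟨j, by omega, h⟩
      · refine ⟨j + 2 ^ t, by omega, ?_⟩
        rw [add_mul, mul_comm (2 ^ t)]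
        convert h using 2
        omega
    · rintro ⟨j, hj, h⟩
      by_cases hj' : j < 2 ^ t
      · exact Or.inl ⟨j, hj', h⟩
      · obtain ⟨j, rfl⟩ := Nat.exists_eq_add_of_le (not_lt.1 hj')
        refine Or.inr ⟨j, by omega, ?_⟩
        rw [add_mul, mul_comm (2 ^ t)] at h
        convert h using 2
        omega

/-- The bitmask of the `i` with `n < 2 * i` and `i < n` that are digits of neither `S` nor `R`. -/
noncomputable def freeMask (n S R : ℕ) : ℕ :=
  (fun U => Nat.xor U (Nat.land U (Nat.lor S R)))
    (Nat.xor (Nat.pred (Nat.pow 2 n)) (Nat.pred (Nat.pow 2 (Nat.succ (Nat.div n 2)))))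

theorem testBit_freeMask {n : ℕ} (hn : 0 < n) (S R i : ℕ) : (freeMask n S R).testBit i = true ↔
    (n < 2 * i ∧ i < n) ∧ ¬ S.testBit i = true ∧ ¬ R.testBit i = true := by
  -- The first exclusive or has digits exactly at `n / 2 < i < n`; the second removes those in `S`
  -- or `R`.
  change (((2 ^ n - 1) ^^^ (2 ^ (n / 2 + 1) - 1)) ^^^
    (((2 ^ n - 1) ^^^ (2 ^ (n / 2 + 1) - 1)) &&& (S ||| R))).testBit i = true ↔ _
  simp only [Nat.testBit_xor, Nat.testBit_land, Nat.testBit_lor, Nat.testBit_two_pow_sub_one]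
  by_cases h1 : i < n <;> by_cases h2 : i < n / 2 + 1
  · have : ¬ n < 2 * i := by omega
    simp [h1, h2, this]
  · have : n < 2 * i := by omega
    simp only [h1, h2, this]
    cases S.testBit i <;> cases R.testBit i <;> simp
  · omega
  · simp [h1, h2]

/-- The step of `countTrunc` that adjoins the generator `k` to `S`. -/
noncomputable def countAdjoin (n : ℕ) (count : ℕ → ℕ → ℕ → ℕ) (k S R : ℕ) : ℕ :=
  force (closeRight R k 6) fun R' =>
    Nat.rec
      (force (Nat.land (closeLeft S k 6) (Nat.pred (Nat.pow 2 (Nat.succ n)))) fun S' =>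
        count (Nat.succ k) S' R')
      (fun _ _ => nat_lit 0) (Nat.land R' (nat_lit 1))

/-- Counts the members of `truncFamilyOver n k S`, where `R` is the mirror image of `S` in
`[0, n]` and `k + fuel` is the least integer greater than `n / 2`, or equal to it. -/
noncomputable def countTrunc (n fuel : ℕ) : ℕ → ℕ → ℕ → ℕ :=
  Nat.rec
    (fun _ S R => force (freeMask n S R) fun F => force S fun S => countUp S (nat_lit 32) F)
    (fun _ ih k S R =>
      Nat.rec (Nat.add (ih (Nat.succ k) S R) (countAdjoin n ih k S R))
        (fun _ _ => ih (Nat.succ k) S R) (Nat.land (Nat.shiftRight S k) (nat_lit 1))) fuel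

theorem rec_land_one (S k a b : ℕ) :
    (Nat.rec a (fun _ _ => b) (Nat.land (Nat.shiftRight S k) (nat_lit 1)) : ℕ) =
      if S.testBit k = true then b else a := by
  have h : Nat.land (Nat.shiftRight S k) (nat_lit 1) = (S.testBit k).toNat := by
    change (S >>> k) &&& 1 = _
    rw [Nat.and_one_is_mod, Nat.toNat_testBit, Nat.shiftRight_eq_div_pow]
  rw [h]
  cases S.testBit k <;> rfl

theorem countTrunc_zero (n k S R : ℕ) :
    countTrunc n 0 k S R = countUp S 32 (freeMask n S R) := by
  change force _ (fun F => force S fun S => countUp S 32 F) = _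
  rw [force_eq, force_eq]

theorem countTrunc_succ (n fuel k S R : ℕ) : countTrunc n (fuel + 1) k S R =
    if S.testBit k = true then countTrunc n fuel (k + 1) S R else
      countTrunc n fuel (k + 1) S R + countAdjoin n (countTrunc n fuel) k S R :=
  rec_land_one S k _ _

theorem countAdjoin_eq (n : ℕ) (count : ℕ → ℕ → ℕ → ℕ) (k S R : ℕ) :
    countAdjoin n count k S R = if (closeRight R k 6).testBit 0 = true then 0 else
      count (k + 1) (closeLeft S k 6 &&& (2 ^ (n + 1) - 1)) (closeRight R k 6) := by
  rw [countAdjoin, force_eq]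
  exact (rec_land_one (closeRight R k 6) 0 _ _).trans (by rw [force_eq]; rfl)

/-- The binary digits of `S` form a subset of `[0, n)`, closed under sums up to `n`, that is
contained in each member of `truncFamilyOver n k S`; and `R` is its mirror image in `[0, n]`. -/
structure IsState (n k S R : ℕ) : Prop where
  zero : S.testBit 0 = true
  lt : ∀ i, S.testBit i = true → i < n
  add : ∀ i j, S.testBit i = true → S.testBit j = true → i + j ≤ n → S.testBit (i + j) = true
  subset : ∀ T ∈ truncFamilyOver n k S, ∀ i, S.testBit i = true → i ∈ T
  mirror : ∀ i, R.testBit i = true ↔ i ≤ n ∧ S.testBit (n - i) = true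

theorem IsState.succ {n k S R : ℕ} (h : IsState n k S R) : IsState n (k + 1) S R where
  zero := h.zero
  lt := h.lt
  add := h.add
  subset T hT := by
    rw [mem_truncFamilyOver] at hT
    exact h.subset T (mem_truncFamilyOver.2 ⟨hT.1, fun i hi => hT.2 i (by omega)⟩)
  mirror := h.mirror

theorem IsState.truncFamilyOver_succ {n k S R : ℕ} (h : IsState n k S R) (hk : S.testBit k = true) :
    truncFamilyOver n (k + 1) S = truncFamilyOver n k S := by
  ext T
  constructor
  · intro hT
    rw [mem_truncFamilyOver] at hT ⊢
    exact ⟨hT.1, fun i hi => hT.2 i (by omega)⟩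
  · intro hT
    have := h.subset T hT k hk
    rw [mem_truncFamilyOver] at hT ⊢
    refine ⟨hT.1, fun i hi => ?_⟩
    rcases Nat.lt_succ_iff_lt_or_eq.1 hi with hi | rfl
    · exact hT.2 i hi
    · exact iff_of_true this hk

theorem multiple_mem {n k s j : ℕ} {T : Finset ℕ} (hT : T ∈ truncFamily n) (hk : k ∈ T)
    (hs : s ∈ T) (h : s + j * k < n) : s + j * k ∈ T := by
  rw [mem_truncFamily] at hT
  induction j with
  | zero => simpa using hs
  | succ j ih =>
    rw [add_mul, one_mul, ← add_assoc] at h ⊢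
    exact (hT.2.2 _ (ih (by omega)) _ hk).2 h

theorem multiple_ne {n k s j : ℕ} {T : Finset ℕ} (hT : T ∈ truncFamily n) (hk : k ∈ T)
    (hs : s ∈ T) : s + j * k ≠ n := by
  intro h
  have hT' := mem_truncFamily.1 hT
  rcases j with _ | j
  · have := hT'.1 s hs
    omega
  · rw [add_mul, one_mul, ← add_assoc] at h
    by_cases hk0 : k = 0
    · have := hT'.1 s hs
      subst hk0
      omega
    · exact (hT'.2.2 _ (multiple_mem (j := j) hT hk hs (by omega)) _ hk).1 h

/-- Closing `R` downwards mirrors closing `S` upwards, so digit `0` of the new `R` records whether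
`n` has become a sum, in which case `k` must be rejected. Below `k` the closure changes nothing, so
earlier decisions stand. -/
theorem IsState.adjoin {n k S R : ℕ} (h : IsState n k S R) (hn : n < 64)
    (hk : S.testBit k ≠ true)  :
    ((closeRight R k 6).testBit 0 = true → ∀ T ∈ truncFamilyOver n k S, k ∉ T) ∧
    ((closeRight R k 6).testBit 0 ≠ true →
      IsState n (k + 1) (closeLeft S k 6 &&& (2 ^ (n + 1) - 1)) (closeRight R k 6)) ∧
    ∀ i ≤ k, k ≤ n → ((closeLeft S k 6 &&& (2 ^ (n + 1) - 1)).testBit i = true ↔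
      S.testBit i = true ∨ i = k) := by
  have hk0 : 1 ≤ k := by
    rcases Nat.eq_zero_or_pos k with rfl | h0
    · exact absurd h.zero hk
    · exact h0
  set S' := closeLeft S k 6 &&& (2 ^ (n + 1) - 1) with hS'
  have hmem : ∀ i, S'.testBit i = true ↔ i ≤ n ∧ ∃ j s, S.testBit s = true ∧ i = s + j * k := by
    intro i
    rw [hS', Nat.testBit_land, Nat.testBit_two_pow_sub_one, Bool.and_eq_true, testBit_closeLeft,
      decide_eq_true_eq]
    constructor
    · rintro ⟨⟨j, -, s, hs, e⟩, hi⟩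
      exact ⟨by omega, j, s, hs, e⟩
    · rintro ⟨hi, j, s, hs, e⟩
      refine ⟨⟨j, ?_, s, hs, e⟩, by omega⟩
      -- As `k ≥ 1`, the multiplier satisfies `j ≤ j * k ≤ n < 64 = 2 ^ 6`; hence six doublings
      -- reach every multiple needed.
      have := Nat.le_mul_of_pos_right j hk0
      norm_num
      omega
  have hR : ∀ i, (closeRight R k 6).testBit i = true ↔ i ≤ n ∧ S'.testBit (n - i) = true := by
    intro i
    rw [testBit_closeRight, hmem]
    simp only [h.mirror]
    constructor
    · rintro ⟨j, -, hj, hs⟩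
      exact ⟨by omega, by omega, j, _, hs, by omega⟩
    · rintro ⟨hi, -, j, s, hs, e⟩
      have := Nat.le_mul_of_pos_right j hk0
      refine ⟨j, by norm_num; omega, by omega, ?_⟩
      rw [show n - (i + j * k) = s by omega]
      exact hs
  have hlow : ∀ i ≤ k, k ≤ n → (S'.testBit i = true ↔ S.testBit i = true ∨ i = k) := by
    intro i hi hkn
    rw [hmem]
    constructor
    · rintro ⟨-, j, s, hs, e⟩
      rcases j with _ | j
      · left
        rw [e, zero_mul, add_zero]
        exact hs
      · right
        rw [add_mul] at e
        omega
    · rintro (hs | rfl)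
      · exact ⟨by omega, 0, i, hs, by simp⟩
      · exact ⟨hkn, 1, 0, h.zero, by simp⟩
  refine ⟨?_, ?_, hlow⟩
  · intro h0 T hT hkT
    obtain ⟨-, h0⟩ := (hR 0).1 h0
    obtain ⟨-, j, s, hs, e⟩ := (hmem _).1 h0
    exact multiple_ne (mem_truncFamilyOver.1 hT).1 hkT (h.subset T hT s hs) e.symm
  · intro h0
    have hlt : ∀ i, S'.testBit i = true → i < n := by
      intro i hi
      refine lt_of_le_of_ne ((hmem i).1 hi).1 ?_
      rintro rfl
      exact h0 ((hR 0).2 ⟨Nat.zero_le _, hi⟩)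
    refine ⟨(hmem 0).2 ⟨Nat.zero_le _, 0, 0, h.zero, by simp⟩, hlt, ?_, ?_, hR⟩
    · intro a b ha hb hab
      obtain ⟨-, j, s, hs, rfl⟩ := (hmem a).1 ha
      obtain ⟨-, j', s', hs', rfl⟩ := (hmem b).1 hb
      refine (hmem _).2 ⟨hab, j + j', s + s', h.add s s' hs hs' (by omega), by ring⟩
    · intro T hT i hi
      have hin := hlt i hi
      rw [mem_truncFamilyOver] at hT
      obtain ⟨-, j, s, hs, rfl⟩ := (hmem i).1 hi
      by_cases hj : j = 0
      · subst hj
        by_cases hkn : k ≤ n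
        · rw [zero_mul, add_zero]
          refine h.subset T (mem_truncFamilyOver.2 ⟨hT.1, fun i hi => ?_⟩) s hs
          rw [hT.2 i (by omega), hlow i (by omega) hkn]
          exact or_iff_left (by omega)
        · exact (hT.2 _ (by omega)).2 hi
      · have h1 : k ≤ j * k := Nat.le_mul_of_pos_left k (by omega)
        have hkn : k ≤ n := by omega
        have hT' : T ∈ truncFamilyOver n k S := by
          refine mem_truncFamilyOver.2 ⟨hT.1, fun i hi => ?_⟩
          rw [hT.2 i (by omega), hlow i (by omega) hkn]
          exact or_iff_left (by omega)
        exact multiple_mem hT.1 ((hT.2 k (by omega)).2 ((hlow k le_rfl hkn).2 (Or.inr rfl)))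
          (h.subset T hT' s hs) hin

/-- The bijection removes the forced elements from `T`. A remaining `x` exceeds `n / 2` and avoids
the mirror image of `S`, and sums of two such elements exceed `n`, so only closure under translation
by `S` is left. -/
theorem IsState.card_truncFamilyOver {n k S R : ℕ} (h : IsState n k S R) (hn : n < 64)
    (hk : k = (n - 1) / 2 + 1) :
    (truncFamilyOver n k S).card = countTrunc n 0 k S R := by
  classical
  have hF := testBit_freeMask (h.lt 0 h.zero) S R
  simp only [h.mirror] at hF
  rw [countTrunc_zero, countUp_eq (n := n) (fun i j hi hj hij => h.add i j hi hj hij.le) 32 _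
    (fun i hi => ((hF i).1 hi).1.2)]
  · refine Finset.card_nbij' (fun T => T \ bits S) (fun X => X ∪ bits S) ?_ ?_ ?_ ?_
    · intro T hT
      have hsub := h.subset T hT
      simp only [Finset.mem_coe, mem_truncFamilyOver, mem_truncFamily] at hT
      obtain ⟨⟨h1, h2, h3⟩, h4⟩ := hT
      simp only [Finset.mem_coe, mem_upFamily, Finset.subset_iff, Finset.mem_sdiff, mem_bits, hF,
        Set.mem_ofPred]
      refine ⟨?_, ?_⟩
      · rintro x ⟨hx, hxS⟩
        have hxn := h1 x hx
        refine ⟨⟨?_, hxn⟩, hxS, ?_⟩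
        -- Elements below `k` are already decided, so `2 * x ≥ n`; equality would make `x + x = n`.
        · have : ¬ x < k := fun hxk => hxS ((h4 x hxk).1 hx)
          have := (h3 x hx x hx).1
          omega
        · rintro ⟨-, h'⟩
          exact (h3 x hx _ (hsub _ h')).1 (by omega)
      · rintro x ⟨hx, hxS⟩ a ha ⟨⟨-, h5⟩, h6, -⟩
        exact ⟨(h3 x hx a (hsub a ha)).2 h5, h6⟩
    · intro X hX
      simp only [Finset.mem_coe, mem_upFamily, Finset.subset_iff, mem_bits, hF,
        Set.mem_ofPred] at hX
      obtain ⟨h1, h2⟩ := hX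
      have key : ∀ x ∈ X, ∀ s, S.testBit s = true →
          x + s ≠ n ∧ (x + s < n → x + s ∈ X ∨ S.testBit (x + s) = true) := by
        intro x hx s hs
        have hxn := (h1 hx).1
        have hxm := (h1 hx).2.2
        have hne : x + s ≠ n := by
          intro e
          exact hxm ⟨by omega, by rw [show n - x = s by omega]; exact hs⟩
        refine ⟨hne, fun hlt => ?_⟩
        by_cases hxs : S.testBit (x + s) = true
        · exact Or.inr hxs
        -- The translate `x + s` is again free: if `n - (x + s)` were in `S`, so would be `n - x`,
        -- and `x` would not be free.
        · refine Or.inl (h2 x hx s hs ⟨⟨by omega, hlt⟩, hxs, ?_⟩)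
          rintro ⟨-, h'⟩
          refine hxm ⟨by omega, ?_⟩
          have := h.add _ s h' hs (by omega)
          rwa [show n - (x + s) + s = n - x by omega] at this
      simp only [Finset.mem_coe, mem_truncFamilyOver, mem_truncFamily, Finset.mem_union, mem_bits]
      refine ⟨⟨?_, Or.inr h.zero, ?_⟩, ?_⟩
      · rintro a (ha | ha)
        · exact (h1 ha).1.2
        · exact h.lt a ha
      · rintro a (ha | ha) b (hb | hb)
        · have := (h1 ha).1
          have := (h1 hb).1
          exact ⟨by omega, by omega⟩
        · exact key a ha b hb
        · rw [add_comm]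
          exact key b hb a ha
        · refine ⟨fun e => ?_, fun hab => Or.inr (h.add a b ha hb hab.le)⟩
          have := h.lt _ (h.add a b ha hb e.le)
          omega
      · intro i hi
        refine or_iff_right fun hiX => ?_
        have := (h1 hiX).1
        omega
    · intro T hT
      have hsub := h.subset T hT
      exact Finset.sdiff_union_of_subset fun i hi => hsub i (mem_bits.1 hi)
    · intro X hX
      simp only [Finset.mem_coe, mem_upFamily, Finset.subset_iff, mem_bits, hF] at hX
      ext i
      simp only [Finset.mem_sdiff, Finset.mem_union, mem_bits]
      constructor
      · rintro ⟨h' | h', h''⟩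
        · exact h'
        · exact absurd h' h''
      · exact fun h' => ⟨Or.inl h', (hX.1 h').2.1⟩
  · have : bits (freeMask n S R) ⊆ Finset.Ioo (n / 2) n := by
      intro i hi
      rw [mem_bits, hF] at hi
      rw [Finset.mem_Ioo]
      omega
    -- For `n < 64` the interval has at most `31` elements, so the fuel `32` suffices.
    refine (Finset.card_le_card this).trans ?_
    rw [Nat.card_Ioo]
    omega

theorem IsState.card_truncFamilyOver_split {n k S R : ℕ} (h : IsState n k S R) (hn : n < 64)
    (hkn : k ≤ n) (hk : S.testBit k ≠ true) :
    (truncFamilyOver n k S).card = (truncFamilyOver n (k + 1) S).card +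
      (truncFamilyOver n (k + 1) (closeLeft S k 6 &&& (2 ^ (n + 1) - 1))).card := by
  classical
  rw [← Finset.card_filter_add_card_filter_not (s := truncFamilyOver n k S) (fun T => k ∉ T)]
  have hlow := (h.adjoin hn hk).2.2
  congr 2
  · ext T
    simp only [Finset.mem_filter, mem_truncFamilyOver, Nat.lt_succ_iff_lt_or_eq, or_imp,
      forall_and, forall_eq, iff_false_right hk, and_assoc]
  · ext T
    simp only [Finset.mem_filter, mem_truncFamilyOver, Nat.lt_succ_iff_lt_or_eq, or_imp,
      forall_and, forall_eq, not_not, and_assoc, hlow k le_rfl hkn, or_true, iff_true]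
    refine and_congr_right fun _ => and_congr_left fun _ => forall₂_congr fun i hi => ?_
    rw [hlow i hi.le hkn, or_iff_left hi.ne]

theorem IsState.card_truncFamilyOver_of_not {n k S R : ℕ} (h : IsState n k S R) (hn : n < 64)
    (hk : S.testBit k ≠ true) (hcl : (closeRight R k 6).testBit 0 = true) :
    truncFamilyOver n k S = truncFamilyOver n (k + 1) S := by
  have hnot := (h.adjoin hn hk).1 hcl
  ext T
  constructor
  · intro hT
    have := hnot T hT
    rw [mem_truncFamilyOver] at hT ⊢
    refine ⟨hT.1, fun i hi => ?_⟩
    rcases Nat.lt_succ_iff_lt_or_eq.1 hi with hi | rfl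
    · exact hT.2 i hi
    · exact iff_of_false this hk
  · intro hT
    rw [mem_truncFamilyOver] at hT ⊢
    exact ⟨hT.1, fun i hi => hT.2 i (by omega)⟩

theorem IsState.card_eq_countTrunc {n fuel k S R : ℕ} (h : IsState n k S R) (hn : n < 64)
    (hk : k + fuel = (n - 1) / 2 + 1) :
    (truncFamilyOver n k S).card = countTrunc n fuel k S R := by
  induction fuel generalizing k S R with
  | zero => exact h.card_truncFamilyOver hn hk
  | succ fuel ih =>
    rw [countTrunc_succ]
    split_ifs with hkS
    · rw [← h.truncFamilyOver_succ hkS, ih h.succ (by omega)]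
    · rw [countAdjoin_eq]
      split_ifs with hcl
      · rw [h.card_truncFamilyOver_of_not hn hkS hcl, ih h.succ (by omega), add_zero]
      · rw [h.card_truncFamilyOver_split hn (by omega) hkS, ih h.succ (by omega),
          ih ((h.adjoin hn hkS).2.1 hcl) (by omega)]

theorem isState_one {n : ℕ} (hn : 0 < n) : IsState n 1 1 (2 ^ n) where
  zero := by simp
  lt i hi := by
    rw [Nat.testBit_one_eq_true_iff_self_eq_zero] at hi
    omega
  add i j hi hj _ := by
    rw [Nat.testBit_one_eq_true_iff_self_eq_zero] at hi hj ⊢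
    omega
  subset T hT i hi := by
    rw [Nat.testBit_one_eq_true_iff_self_eq_zero] at hi
    rw [mem_truncFamilyOver, mem_truncFamily] at hT
    rw [hi]
    exact hT.1.2.1
  mirror i := by
    rw [Nat.testBit_two_pow, decide_eq_true_eq, Nat.testBit_one_eq_true_iff_self_eq_zero]
    omega

theorem card_truncFamily {n : ℕ} (hn : 0 < n) (hn' : n < 64) :
    (truncFamily n).card = countTrunc n ((n - 1) / 2) 1 1 (2 ^ n) := by
  rw [← (isState_one hn).card_eq_countTrunc hn' (by omega)]
  congr 1
  ext T
  rw [mem_truncFamilyOver]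
  refine ⟨fun hT => ⟨hT, fun i hi => ?_⟩, fun h => h.1⟩
  rw [Nat.lt_one_iff] at hi
  subst hi
  exact iff_of_true (mem_truncFamily.1 hT).2.1 (by simp)

/-! ### Splitting the count by the least positive element -/

/-- The number of members of `truncFamily n` whose least positive element is `k`, where
`k + fuel + 1` is the least integer greater than `n / 2`, or equal to it. -/
noncomputable def countLeast (n fuel k : ℕ) : ℕ :=
  countAdjoin n (countTrunc n fuel) k 1 (Nat.pow 2 n)

/-- Unfolding the path that rejects every candidate cuts the tree at the first accepted one. The
pieces can be evaluated separately; the leading term counts the traces that accept none. -/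
theorem countTrunc_one (n fuel k : ℕ) :
    countTrunc n fuel (k + 1) 1 (2 ^ n) = countTrunc n 0 (k + 1 + fuel) 1 (2 ^ n) +
      ∑ f ∈ Finset.range fuel, countLeast n f (k + fuel - f) := by
  induction fuel generalizing k with
  | zero => simp
  | succ fuel ih =>
    have h : ¬ Nat.testBit 1 (k + 1) = true := by
      rw [Nat.testBit_one_eq_true_iff_self_eq_zero]
      omega
    rw [countTrunc_succ, if_neg h, ih (k + 1), Finset.sum_range_succ, add_assoc,
      show k + (fuel + 1) - fuel = k + 1 by omega, show k + 1 + (fuel + 1) = k + 1 + 1 + fuel by omega,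
      show k + (fuel + 1) = k + 1 + fuel by omega]
    rfl

theorem card_truncFamily_eq_sum {n h : ℕ} (hn : 0 < n) (hn' : n < 64) (hh : h = (n - 1) / 2) :
    (truncFamily n).card = countTrunc n 0 (h + 1) 1 (2 ^ n) +
      ∑ f ∈ Finset.range h, countLeast n f (h - f) := by
  rw [card_truncFamily hn hn', ← hh, countTrunc_one n h 0, zero_add, zero_add, add_comm 1 h]
-- Semigroups with given Frobenius number as traces
/-- The elements of `S` that are less than `n`. -/
noncomputable def trace (n : ℕ) (S : AddSubmonoid ℕ) : Finset ℕ := by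
  classical
  exact (Finset.range n).filter (· ∈ S)

theorem mem_trace {n a : ℕ} {S : AddSubmonoid ℕ} : a ∈ trace n S ↔ a < n ∧ a ∈ S := by
  simp [trace]

/-- The union of `T` and `[b, ∞)` as a submonoid, for a member `T` of `truncFamily n`. -/
def extend {n : ℕ} {T : Finset ℕ} (hT : T ∈ truncFamily n) (b : ℕ) (hb : n ≤ b ∧ b ≤ n + 1) :
    AddSubmonoid ℕ where
  carrier := {a | a ∈ T ∨ b ≤ a}
  zero_mem' := Or.inl (mem_truncFamily.1 hT).2.1
  add_mem' := by
    intro x y hx hy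
    simp only [Set.mem_ofPred] at hx hy ⊢
    by_cases h : x ∈ T ∧ y ∈ T
    · have := (mem_truncFamily.1 hT).2.2 x h.1 y h.2
      by_cases h' : x + y < n
      · exact Or.inl (this.2 h')
      · right
        omega
    · right
      rcases hx with hx | hx <;> rcases hy with hy | hy
      · exact absurd ⟨hx, hy⟩ h
      all_goals omega

theorem mem_extend {n : ℕ} {T : Finset ℕ} (hT : T ∈ truncFamily n) {b : ℕ}
    (hb : n ≤ b ∧ b ≤ n + 1) {a : ℕ} : a ∈ extend hT b hb ↔ a ∈ T ∨ b ≤ a := Iff.rfl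

theorem mem_frobSet_iff {n : ℕ} {S : AddSubmonoid ℕ} :
    S ∈ frobSet n ↔ n ∉ S ∧ ∀ k > n, k ∈ S := by
  rw [frobSet, Set.mem_ofPred, frobeniusNumber_iff, AddSubmonoid.closure_eq]
  refine and_iff_right_of_imp fun h => (Set.finite_Iic n).subset fun k hk => ?_
  by_contra hc
  exact hk (h.2 k (not_le.1 hc))

theorem frobCard_eq (n : ℕ) : frobCard n = (truncFamily n).card := by
  rw [frobCard, ← Set.ncard_coe_finset]
  refine Set.ncard_congr (fun S _ => trace n S) ?_ ?_ ?_
  · intro S hS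
    rw [mem_frobSet_iff] at hS
    have h0 : n ≠ 0 := fun h => hS.1 (h ▸ S.zero_mem)
    simp only [Finset.mem_coe, mem_truncFamily, mem_trace]
    refine ⟨fun a ha => ha.1, ⟨by omega, S.zero_mem⟩, fun a ha b hb => ⟨?_, ?_⟩⟩
    · rintro rfl
      exact hS.1 (S.add_mem ha.2 hb.2)
    · exact fun h => ⟨h, S.add_mem ha.2 hb.2⟩
  · intro S S' hS hS' h
    rw [mem_frobSet_iff] at hS hS'
    ext a
    rcases lt_trichotomy a n with ha | rfl | ha
    · have := congrArg (a ∈ ·) h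
      simpa only [mem_trace, ha, true_and, eq_iff_iff] using this
    · exact iff_of_false hS.1 hS'.1
    · exact iff_of_true (hS.2 a ha) (hS'.2 a ha)
  · intro T hT
    have hlt := (mem_truncFamily.1 hT).1
    refine ⟨extend hT (n + 1) ⟨by omega, le_rfl⟩, ?_, ?_⟩
    · rw [mem_frobSet_iff]
      simp only [mem_extend]
      refine ⟨?_, fun k hk => Or.inr hk⟩
      rintro (h | h)
      · exact lt_irrefl _ (hlt n h)
      · omega
    · ext a
      rw [mem_trace, mem_extend]
      constructor
      · rintro ⟨h, h' | h'⟩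
        · exact h'
        · omega
      · exact fun h => ⟨hlt a h, Or.inl h⟩

/-! ### Primitives as irreducible elements -/

/-- The elements of `S` that are not zero and not a sum of two nonzero elements of `S`. -/
def irreducibles (S : AddSubmonoid ℕ) : Set ℕ :=
  {a | a ∈ S ∧ a ≠ 0 ∧ ∀ x ∈ S, ∀ y ∈ S, x + y = a → x = 0 ∨ y = 0}

theorem closure_irreducibles (S : AddSubmonoid ℕ) : AddSubmonoid.closure (irreducibles S) = S := by
  refine le_antisymm ((AddSubmonoid.closure_le).2 fun a ha => ha.1) fun a ha => ?_
  induction a using Nat.strong_induction_on with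
  | _ a ih =>
  by_cases h0 : a = 0
  · exact h0 ▸ AddSubmonoid.zero_mem _
  by_cases h : a ∈ irreducibles S
  · exact AddSubmonoid.subset_closure h
  · have : ∃ x ∈ S, ∃ y ∈ S, x + y = a ∧ x ≠ 0 ∧ y ≠ 0 := by
      by_contra hc
      push Not at hc
      exact h ⟨ha, h0, fun x hx y hy e => or_iff_not_imp_left.2 (hc x hx y hy e)⟩
    obtain ⟨x, hx, y, hy, rfl, hx0, hy0⟩ := this
    exact AddSubmonoid.add_mem _ (ih x (by omega) hx) (ih y (by omega) hy)

/-- A nonzero element of the closure is a generator or a sum of two nonzero elements of the closure.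
Hence every generating set contains the irreducibles, which are therefore the primitives. -/
theorem irreducibles_closure_subset (A : Set ℕ) :
    irreducibles (AddSubmonoid.closure A) ⊆ A := by
  rintro a ⟨ha, h0, h⟩
  have : a = 0 ∨ a ∈ A ∨ ∃ x ∈ AddSubmonoid.closure A, ∃ y ∈ AddSubmonoid.closure A,
      x + y = a ∧ x ≠ 0 ∧ y ≠ 0 := by
    clear h h0
    induction ha using AddSubmonoid.closure_induction with
    | mem x hx => exact Or.inr (Or.inl hx)
    | zero => exact Or.inl rfl
    | add x y hx hy ihx ihy =>
      by_cases hx0 : x = 0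
      · simpa [hx0] using ihy
      by_cases hy0 : y = 0
      · simpa [hy0] using ihx
      exact Or.inr (Or.inr ⟨x, hx, y, hy, rfl, hx0, hy0⟩)
  rcases this with h' | h' | ⟨x, hx, y, hy, e, hx0, hy0⟩
  · exact absurd h' h0
  · exact h'
  · rcases h x hx y hy e with h' | h' <;> contradiction

theorem IsSetOfPrimitives.coe_eq {S : AddSubmonoid ℕ} {P : Finset ℕ}
    (h : IsSetOfPrimitives S P) : (P : Set ℕ) = irreducibles S := by
  have hP : AddSubmonoid.closure (P : Set ℕ) = S := h.1
  have hsub : irreducibles S ⊆ P := hP ▸ irreducibles_closure_subset (P : Set ℕ)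
  refine subset_antisymm ?_ hsub
  have hfin := P.finite_toSet.subset hsub
  have : P ≤ hfin.toFinset := h.2 (by simp [closure_irreducibles])
  intro a ha
  simpa using this ha

theorem isSetOfPrimitives_of_coe_eq {S : AddSubmonoid ℕ} {P : Finset ℕ}
    (h : (P : Set ℕ) = irreducibles S) : IsSetOfPrimitives S P := by
  refine ⟨?_, fun A hA => ?_⟩
  · simp [h, closure_irreducibles]
  · have hA' : AddSubmonoid.closure (A : Set ℕ) = S := hA
    rw [← Finset.coe_subset, h, ← hA']
    exact irreducibles_closure_subset _

theorem hasMaxPrimitive_iff {S : AddSubmonoid ℕ} {n : ℕ} :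
    HasMaxPrimitive S n ↔ IsGreatest (irreducibles S) n := by
  constructor
  · rintro ⟨P, hP, h⟩
    rwa [hP.coe_eq] at h
  · intro h
    have hfin : (irreducibles S).Finite := (Set.finite_Iic n).subset h.2
    refine ⟨hfin.toFinset, isSetOfPrimitives_of_coe_eq (by simp), by simpa using h⟩

theorem isNumericalSemigroup_closure_iff {A : Set ℕ} :
    IsNumericalSemigroup (AddSubmonoid.closure A) ↔ ∀ d, (∀ a ∈ A, d ∣ a) → d = 1 := by
  constructor
  · intro h d hd
    obtain ⟨b, hb⟩ := h.bddAbove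
    have hmem : ∀ m, b < m → d ∣ m := by
      intro m hm
      have : m ∈ AddSubmonoid.closure A := by
        by_contra hc
        exact absurd (hb hc) (not_le.2 hm)
      exact ((Nat.dvd_setGcd_iff.2 hd)).trans (Nat.setGcd_dvd_of_mem_closure this)
    -- A common divisor divides two consecutive large numbers.
    have := (Nat.dvd_add_right (hmem (b + 1) (by omega))).1 (hmem (b + 1 + 1) (by omega))
    exact Nat.dvd_one.1 this
  · intro h
    have h1 := h (Nat.setGcd A) fun a ha => Nat.setGcd_dvd_of_mem ha
    obtain ⟨b, hb⟩ := Nat.exists_mem_closure_of_ge A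
    refine (Set.finite_Iio b).subset fun m hm => ?_
    by_contra hc
    exact hm (hb m (not_lt.1 hc) (h1 ▸ one_dvd m))

/-! ### Maximum primitive: traces coprime to `n` -/

/-- The members of `truncFamily n` whose elements have no common divisor with `n` except `1`. -/
noncomputable def coprimeTruncFamily (n : ℕ) : Finset (Finset ℕ) := by
  classical
  exact (truncFamily n).filter fun T => ∀ d, d ∣ n → (∀ a ∈ T, d ∣ a) → d = 1

theorem mem_coprimeTruncFamily {n : ℕ} {T : Finset ℕ} : T ∈ coprimeTruncFamily n ↔
    T ∈ truncFamily n ∧ ∀ d, d ∣ n → (∀ a ∈ T, d ∣ a) → d = 1 := by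
  simp [coprimeTruncFamily]

theorem closure_insert_trace {n : ℕ} {S : AddSubmonoid ℕ} (h : IsGreatest (irreducibles S) n) :
    AddSubmonoid.closure (insert n (trace n S : Set ℕ)) = S := by
  refine le_antisymm (AddSubmonoid.closure_le.2 ?_) ?_
  · rintro a (rfl | ha)
    · exact h.1.1
    · exact (mem_trace.1 ha).2
  · conv_lhs => rw [← closure_irreducibles S]
    refine AddSubmonoid.closure_mono fun a ha => ?_
    rcases (h.2 ha).lt_or_eq with h' | h'
    · exact Or.inr (mem_trace.2 ⟨h', ha.1⟩)
    · exact Or.inl h'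

theorem trace_closure_insert {n : ℕ} {T : Finset ℕ} (hT : T ∈ truncFamily n) :
    trace n (AddSubmonoid.closure (insert n (T : Set ℕ))) = T := by
  ext a
  rw [mem_trace]
  constructor
  · rintro ⟨han, ha⟩
    -- Adjoining the generator `n` adds nothing below `n`, because `T ∪ [n, ∞)` is already a
    -- submonoid.
    have : AddSubmonoid.closure (insert n (T : Set ℕ)) ≤ extend hT n ⟨le_rfl, by omega⟩ := by
      rw [AddSubmonoid.closure_le]
      rintro b (rfl | hb)
      · exact Or.inr le_rfl
      · exact Or.inl hb
    rcases this ha with h | h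
    · exact h
    · exact absurd h (not_le.2 han)
  · exact fun ha => ⟨(mem_truncFamily.1 hT).1 a ha, AddSubmonoid.subset_closure (Or.inr ha)⟩

theorem isGreatest_irreducibles_closure_insert {n : ℕ} {T : Finset ℕ} (hT : T ∈ truncFamily n) :
    IsGreatest (irreducibles (AddSubmonoid.closure (insert n (T : Set ℕ)))) n := by
  have hlt := (mem_truncFamily.1 hT).1
  have h0 := hlt 0 (mem_truncFamily.1 hT).2.1
  refine ⟨⟨AddSubmonoid.subset_closure (Or.inl rfl), h0.ne', ?_⟩, ?_⟩
  · intro x hx y hy e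
    by_contra! hc
    have hx' : x ∈ T := by
      rw [← trace_closure_insert hT]
      exact mem_trace.2 ⟨by omega, hx⟩
    have hy' : y ∈ T := by
      rw [← trace_closure_insert hT]
      exact mem_trace.2 ⟨by omega, hy⟩
    exact ((mem_truncFamily.1 hT).2.2 x hx' y hy').1 e
  · intro a ha
    rcases irreducibles_closure_subset _ ha with rfl | h
    · exact le_rfl
    · exact (hlt a h).le

theorem trace_mem_truncFamily {n : ℕ} {S : AddSubmonoid ℕ} (h : IsGreatest (irreducibles S) n) :
    trace n S ∈ truncFamily n := by
  have h0 := h.1.2.1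
  simp only [mem_truncFamily, mem_trace]
  refine ⟨fun a ha => ha.1, ⟨by omega, S.zero_mem⟩, fun a ha b hb => ⟨fun e => ?_, ?_⟩⟩
  · rcases h.1.2.2 a ha.2 b hb.2 e with rfl | rfl <;> omega
  · exact fun hab => ⟨hab, S.add_mem ha.2 hb.2⟩

theorem maxPrimCard_eq (n : ℕ) : maxPrimCard n = (coprimeTruncFamily n).card := by
  rw [maxPrimCard, ← Set.ncard_coe_finset]
  have hmem : ∀ S, S ∈ maxPrimSet n ↔ IsNumericalSemigroup S ∧ IsGreatest (irreducibles S) n :=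
    fun S => and_congr_right fun _ => hasMaxPrimitive_iff
  refine Set.ncard_congr (fun S _ => trace n S) ?_ ?_ ?_
  · intro S hS
    rw [hmem] at hS
    refine mem_coprimeTruncFamily.2 ⟨trace_mem_truncFamily hS.2, fun d hdn hd => ?_⟩
    have := hS.1
    rw [← closure_insert_trace hS.2, isNumericalSemigroup_closure_iff] at this
    refine this d ?_
    rintro a (rfl | ha)
    · exact hdn
    · exact hd a ha
  · intro S S' hS hS' h
    rw [← closure_insert_trace ((hmem S).1 hS).2, ← closure_insert_trace ((hmem S').1 hS').2, h]
  · intro T hT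
    obtain ⟨hT, hd⟩ := mem_coprimeTruncFamily.1 hT
    refine ⟨_, (hmem _).2 ⟨isNumericalSemigroup_closure_iff.2 fun d h => ?_,
      isGreatest_irreducibles_closure_insert hT⟩, trace_closure_insert hT⟩
    exact hd d (h n (Or.inl rfl)) fun a ha => h a (Or.inr ha)

theorem singleton_zero_mem_truncFamily {n : ℕ} (hn : 0 < n) : {0} ∈ truncFamily n := by
  rw [mem_truncFamily]
  simp only [Finset.mem_singleton, forall_eq, add_zero]
  exact ⟨hn, trivial, hn.ne, fun _ => trivial⟩

theorem eq_singleton_zero {n : ℕ} {T : Finset ℕ} (hT : T ∈ truncFamily n)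
    (h : ∀ a ∈ T, a = 0) : T = {0} :=
  Finset.eq_singleton_iff_unique_mem.2 ⟨(mem_truncFamily.1 hT).2.1, h⟩

/-- The only bad divisor is `p`, and `0` is its only multiple in `[0, p)`. -/
theorem card_coprimeTruncFamily_of_prime {p : ℕ} (hp : p.Prime) :
    (coprimeTruncFamily p).card + 1 = (truncFamily p).card := by
  classical
  rw [← Finset.card_erase_add_one (singleton_zero_mem_truncFamily hp.pos)]
  congr 2
  ext T
  rw [mem_coprimeTruncFamily, Finset.mem_erase, and_comm]
  refine and_congr_left fun hT => ?_
  constructor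
  · rintro h rfl
    exact hp.one_lt.ne' (h p dvd_rfl (by simp))
  · intro h d hd hdT
    refine ((Nat.dvd_prime hp).1 hd).resolve_right ?_
    rintro rfl
    exact h (eq_singleton_zero hT fun a ha =>
      Nat.eq_zero_of_dvd_of_lt (hdT a ha) ((mem_truncFamily.1 hT).1 a ha))

/-- A nontrivial common divisor has prime factor `2` or `p`. Multiples of `p` below `2 * p` are `0`
and `p`, and `p + p = 2 * p` rules out `p`; so in either case all elements are even, and halving
gives a trace for `p`. -/
theorem card_coprimeTruncFamily_two_mul {p : ℕ} (hp : p.Prime) :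
    (coprimeTruncFamily (2 * p)).card + (truncFamily p).card = (truncFamily (2 * p)).card := by
  rw [← Finset.card_filter_add_card_filter_not (s := truncFamily (2 * p))
    (fun T => ¬ ∀ a ∈ T, 2 ∣ a)]
  congr 1
  · congr 1
    ext T
    rw [mem_coprimeTruncFamily, Finset.mem_filter]
    refine and_congr_right fun hT => ?_
    constructor
    · exact fun h h2 => absurd (h 2 (dvd_mul_right 2 p) h2) (by norm_num)
    · intro h d hd hdT
      obtain ⟨hlt, -, hadd⟩ := mem_truncFamily.1 hT
      by_contra hd1
      obtain ⟨q, hq, hqd⟩ := Nat.exists_prime_and_dvd hd1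
      rcases (Nat.Prime.dvd_mul hq).1 (hqd.trans hd) with hq2 | hqp
      · rw [Nat.prime_dvd_prime_iff_eq hq Nat.prime_two] at hq2
        exact h fun a ha => hq2 ▸ hqd.trans (hdT a ha)
      · rw [Nat.prime_dvd_prime_iff_eq hq hp] at hqp
        subst hqp
        refine h fun a ha => ?_
        obtain ⟨c, rfl⟩ := hqd.trans (hdT a ha)
        have hc : c < 2 := by
          have := hlt _ ha
          rw [mul_comm 2 q] at this
          exact lt_of_mul_lt_mul_left this (Nat.zero_le _)
        interval_cases c
        · simp
        · exact absurd (by ring) (hadd _ ha _ ha).1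
  · refine Finset.card_nbij' (fun T => T.image (2 * ·)) (fun T => T.image (· / 2)) ?_ ?_ ?_ ?_
    · intro T hT
      obtain ⟨hlt, h0, hadd⟩ := mem_truncFamily.1 hT
      simp only [Finset.coe_filter, Set.mem_ofPred, mem_truncFamily, Finset.forall_mem_image,
        not_not]
      refine ⟨⟨fun a ha => ?_, Finset.mem_image.2 ⟨0, h0, rfl⟩, fun a ha b hb => ?_⟩,
        fun a _ => dvd_mul_right 2 a⟩
      · have := hlt a ha
        omega
      · have := hadd a ha b hb
        refine ⟨by omega, fun h => Finset.mem_image.2 ⟨a + b, this.2 (by omega), by ring⟩⟩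
    · intro T hT
      simp only [Finset.coe_filter, Set.mem_ofPred, mem_truncFamily, not_not] at hT
      obtain ⟨⟨hlt, h0, hadd⟩, heven⟩ := hT
      simp only [Finset.mem_coe, mem_truncFamily, Finset.forall_mem_image]
      refine ⟨fun a ha => ?_, Finset.mem_image.2 ⟨0, h0, rfl⟩, fun a ha b hb => ?_⟩
      · have := hlt a ha
        omega
      · have := hadd a ha b hb
        have := heven a ha
        have := heven b hb
        refine ⟨by omega, fun h => Finset.mem_image.2 ⟨a + b, ?_, by omega⟩⟩
        exact (hadd a ha b hb).2 (by omega)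
    · intro T _
      simp [Finset.image_image, Function.comp_def]
    · intro T hT
      simp only [Finset.coe_filter, Set.mem_ofPred, not_not] at hT
      change (T.image (· / 2)).image (2 * ·) = T
      rw [Finset.image_image]
      conv_rhs => rw [← Finset.image_id (s := T)]
      refine Finset.image_congr fun a ha => ?_
      exact Nat.mul_div_cancel' (hT.2 a ha)
-- Kernel evaluation and conclusion
theorem card_truncFamily_31 : (truncFamily 31).card = 70854 := by
  rw [card_truncFamily (by norm_num) (by norm_num)]
  decide +kernel

theorem sum_range_thirty (u : ℕ → ℕ → ℕ) : ∑ f ∈ Finset.range 30, u f (30 - f) =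
      u 0 30 + u 1 29 + u 2 28 + u 3 27 + u 4 26 + u 5 25 + u 6 24 + u 7 23 + u 8 22 + u 9
      21 + u 10 20 + u 11 19 + u 12 18 + u 13 17 + u 14 16 + u 15 15 + u 16 14 + u 17 13 +
      u 18 12 + u 19 11 + u 20 10 + u 21 9 + u 22 8 + u 23 7 + u 24 6 + u 25 5 + u 26 4 +
      u 27 3 + u 28 2 + u 29 1 := by
  simp only [Finset.sum_range_succ, Finset.sum_range_zero, Nat.reduceSub, zero_add]

theorem countLeast_61_30 : countLeast 61 0 30 = 268435456 := by decide +kernel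
theorem countLeast_61_29 : countLeast 61 1 29 = 234881024 := by decide +kernel
theorem countLeast_61_28 : countLeast 61 2 28 = 209715200 := by decide +kernel
theorem countLeast_61_27 : countLeast 61 3 27 = 179830784 := by decide +kernel
theorem countLeast_61_26 : countLeast 61 4 26 = 147390464 := by decide +kernel
theorem countLeast_61_25 : countLeast 61 5 25 = 125739008 := by decide +kernel
theorem countLeast_61_24 : countLeast 61 6 24 = 102835200 := by decide +kernel
theorem countLeast_61_23 : countLeast 61 7 23 = 81534464 := by decide +kernel
theorem countLeast_61_22 : countLeast 61 8 22 = 67442112 := by decide +kernel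
theorem countLeast_61_21 : countLeast 61 9 21 = 53982664 := by decide +kernel
theorem countLeast_61_20 : countLeast 61 10 20 = 31175951 := by decide +kernel
theorem countLeast_61_19 : countLeast 61 11 19 = 21023448 := by decide +kernel
theorem countLeast_61_18 : countLeast 61 12 18 = 16482290 := by decide +kernel
theorem countLeast_61_17 : countLeast 61 13 17 = 10161156 := by decide +kernel
theorem countLeast_61_16 : countLeast 61 14 16 = 7822325 := by decide +kernel
theorem countLeast_61_15 : countLeast 61 15 15 = 3591955 := by decide +kernel
theorem countLeast_61_14 : countLeast 61 16 14 = 2389673 := by decide +kernel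
theorem countLeast_61_13 : countLeast 61 17 13 = 1262154 := by decide +kernel
theorem countLeast_61_12 : countLeast 61 18 12 = 709670 := by decide +kernel
theorem countLeast_61_11 : countLeast 61 19 11 = 306188 := by decide +kernel
theorem countLeast_61_10 : countLeast 61 20 10 = 153910 := by decide +kernel
theorem countLeast_61_9 : countLeast 61 21 9 = 61998 := by decide +kernel
theorem countLeast_61_8 : countLeast 61 22 8 = 26919 := by decide +kernel
theorem countLeast_61_7 : countLeast 61 23 7 = 7102 := by decide +kernel
theorem countLeast_61_6 : countLeast 61 24 6 = 2580 := by decide +kernel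
theorem countLeast_61_5 : countLeast 61 25 5 = 438 := by decide +kernel
theorem countLeast_61_4 : countLeast 61 26 4 = 114 := by decide +kernel
theorem countLeast_61_3 : countLeast 61 27 3 = 11 := by decide +kernel
theorem countLeast_61_2 : countLeast 61 28 2 = 1 := by decide +kernel
theorem countLeast_61_1 : countLeast 61 29 1 = 0 := by decide +kernel

/-- With no positive element up to `30`, any subset of the `30` numbers from `31` to `60` is
allowed, which gives `2 ^ 30`. -/
theorem countTrunc_61 : countTrunc 61 0 (30 + 1) 1 (2 ^ 61) = 1073741824 := by decide +kernel

theorem card_truncFamily_61 : (truncFamily 61).card = 2640706083 := by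
  rw [card_truncFamily_eq_sum (h := 30) (by norm_num) (by norm_num) (by norm_num), countTrunc_61]
  rw [sum_range_thirty,
    countLeast_61_30, countLeast_61_29, countLeast_61_28, countLeast_61_27,
    countLeast_61_26, countLeast_61_25, countLeast_61_24, countLeast_61_23,
    countLeast_61_22, countLeast_61_21, countLeast_61_20, countLeast_61_19,
    countLeast_61_18, countLeast_61_17, countLeast_61_16, countLeast_61_15,
    countLeast_61_14, countLeast_61_13, countLeast_61_12, countLeast_61_11,
    countLeast_61_10, countLeast_61_9, countLeast_61_8, countLeast_61_7, countLeast_61_6,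
    countLeast_61_5, countLeast_61_4, countLeast_61_3, countLeast_61_2, countLeast_61_1]

theorem countLeast_62_30 : countLeast 62 0 30 = 268435456 := by decide +kernel
theorem countLeast_62_29 : countLeast 62 1 29 = 234881024 := by decide +kernel
theorem countLeast_62_28 : countLeast 62 2 28 = 201326592 := by decide +kernel
theorem countLeast_62_27 : countLeast 62 3 27 = 174850048 := by decide +kernel
theorem countLeast_62_26 : countLeast 62 4 26 = 147881984 := by decide +kernel
theorem countLeast_62_25 : countLeast 62 5 25 = 118362112 := by decide +kernel
theorem countLeast_62_24 : countLeast 62 6 24 = 101001216 := by decide +kernel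
theorem countLeast_62_23 : countLeast 62 7 23 = 80912512 := by decide +kernel
theorem countLeast_62_22 : countLeast 62 8 22 = 64409328 := by decide +kernel
theorem countLeast_62_21 : countLeast 62 9 21 = 52219388 := by decide +kernel
theorem countLeast_62_20 : countLeast 62 10 20 = 29350884 := by decide +kernel
theorem countLeast_62_19 : countLeast 62 11 19 = 19712971 := by decide +kernel
theorem countLeast_62_18 : countLeast 62 12 18 = 14905889 := by decide +kernel
theorem countLeast_62_17 : countLeast 62 13 17 = 9987250 := by decide +kernel
theorem countLeast_62_16 : countLeast 62 14 16 = 6679997 := by decide +kernel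
theorem countLeast_62_15 : countLeast 62 15 15 = 3614906 := by decide +kernel
theorem countLeast_62_14 : countLeast 62 16 14 = 2109714 := by decide +kernel
theorem countLeast_62_13 : countLeast 62 17 13 = 1262574 := by decide +kernel
theorem countLeast_62_12 : countLeast 62 18 12 = 601365 := by decide +kernel
theorem countLeast_62_11 : countLeast 62 19 11 = 301122 := by decide +kernel
theorem countLeast_62_10 : countLeast 62 20 10 = 126128 := by decide +kernel
theorem countLeast_62_9 : countLeast 62 21 9 = 62259 := by decide +kernel
theorem countLeast_62_8 : countLeast 62 22 8 = 20809 := by decide +kernel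
theorem countLeast_62_7 : countLeast 62 23 7 = 7088 := by decide +kernel
theorem countLeast_62_6 : countLeast 62 24 6 = 1942 := by decide +kernel
theorem countLeast_62_5 : countLeast 62 25 5 = 438 := by decide +kernel
theorem countLeast_62_4 : countLeast 62 26 4 = 72 := by decide +kernel
theorem countLeast_62_3 : countLeast 62 27 3 = 11 := by decide +kernel
theorem countLeast_62_2 : countLeast 62 28 2 = 0 := by decide +kernel
theorem countLeast_62_1 : countLeast 62 29 1 = 0 := by decide +kernel

theorem countTrunc_62 : countTrunc 62 0 (30 + 1) 1 (2 ^ 62) = 1073741824 := by decide +kernel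

theorem card_truncFamily_62 : (truncFamily 62).card = 2606766903 := by
  rw [card_truncFamily_eq_sum (h := 30) (by norm_num) (by norm_num) (by norm_num), countTrunc_62]
  rw [sum_range_thirty,
    countLeast_62_30, countLeast_62_29, countLeast_62_28, countLeast_62_27,
    countLeast_62_26, countLeast_62_25, countLeast_62_24, countLeast_62_23,
    countLeast_62_22, countLeast_62_21, countLeast_62_20, countLeast_62_19,
    countLeast_62_18, countLeast_62_17, countLeast_62_16, countLeast_62_15,
    countLeast_62_14, countLeast_62_13, countLeast_62_12, countLeast_62_11,
    countLeast_62_10, countLeast_62_9, countLeast_62_8, countLeast_62_7, countLeast_62_6,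
    countLeast_62_5, countLeast_62_4, countLeast_62_3, countLeast_62_2, countLeast_62_1]

theorem mainTheorem3 :
    maxPrimCard 61 = 2640706082 ∧ maxPrimCard 62 = 2606696049 ∧
      frobCard 61 = 2640706083 ∧ frobCard 62 = 2606766903 := by
  have h61 := card_coprimeTruncFamily_of_prime (p := 61) (by norm_num)
  have h62 := card_coprimeTruncFamily_two_mul (p := 31) (by norm_num)
  rw [card_truncFamily_61] at h61
  rw [show 2 * 31 = 62 from rfl, card_truncFamily_62, card_truncFamily_31] at h62
  rw [maxPrimCard_eq, maxPrimCard_eq, frobCard_eq, frobCard_eq, card_truncFamily_61,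
    card_truncFamily_62]
  omega
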